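/- **Notation.** For a modulus $k\ge 0$ let $$F_J(\psi,k)=\int_0^\psi\frac{dt}{\sqrt{1-k^2\sin^2t}},\qquad E_J(\psi,k)=\int_0^\psi\sqrt{1-k^2\sin^2t}\,dt,\qquad K(k)=F_J(\pi/2,k),$$ where $\psi$ ranges over $D_k=\mathbb R$ if $k<1$, $D_k=(-\pi/2,\pi/2)$ if $k=1$, and $D_k=[-\arcsin\frac1k,\arcsin\frac1k]$ if $k>1$. Let $\mathrm{am}(\cdot,k)$ be the inverse of $F_J(\cdot,k):D_k\to F_J(D_k,k)$, and $\mathrm{sn}=\sin\mathrm{am}$, $\mathrm{cn}=\cos\mathrm{am}$, $\mathrm{dn}=\sqrt{1-k^2\mathrm{sn}^2}$. **Data.** Let $EI>0$, $L>0$ and let $X,Z$ (left-end force), $M$ (left-end moment) and $\varphi_a$ (left-end rotation) be real numbers, not satisfying both $M=0$ and $X\sin\varphi_a+Z\cos\varphi_a=0$ (in that excluded case the rotation is constant). Put $$\kappa_a=-\frac{M}{EI},\quad F=\sqrt{X^2+Z^2},\quad N=-X\cos\varphi_a+Z\sin\varphi_a,\quad c_1=\kappa_a^2+\frac{2N}{EI},\quad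 A=\frac{2F}{EI},$$ and let $s=\operatorname{sgn}\kappa_a$ if $\kappa_a\neq0$ and $s=-\operatorname{sgn}(X\sin\varphi_a+Z\cos\varphi_a)$ if $\kappa_a=0$. Then $c_1+A>0$, and we put $$k=\sqrt{\frac{2A}{c_1+A}}=\sqrt{\frac{4F}{2(F+N)+EI\kappa_a^2}}.$$ Let $\alpha$ be an angle of the end force, i.e. $F\cos\alpha=X$ and $F\sin\alpha=Z$, chosen such that $|\varphi_a+\alpha|\le\pi$ if $k\ge1$. Such an $\alpha$ exists; if $X>0$, then $\alpha=\arctan(Z/X)$ is one, provided that it meets the last requirement. Finally put $$a=F_J\Big(\frac{\varphi_a+\alpha}2,k\Big),\qquad b=\frac{s}{2}\sqrt{c_1+A}.$$ **Statement.** Say that $\varphi$ is a *rotation without inflexion point on $[0,L]$* if it is twice differentiable on $[0,L]$, satisfies $EI\varphi''+X\sin\varphi+Z\cos\varphi=0$ there, $\varphi(0)=\varphi_a$, $\varphi'(0)=\kappa_a$, and $\varphi'$ does not change its sign on $[0,L]$. The associated centerline displacements of the axially inextensible beam are the functions $u,w$ with $u'=\cos\varphi-1$, $w'=-\sin\varphi$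 on $[0,L]$. 1. $\varphi$ is a rotation without inflexion point on $[0,L]$ if and only if, for all $x\in[0,L]$, $a+bx\in F_J(D_k,k)$ and $$\varphi(x)=2\,\mathrm{am}(a+bx,k)-\alpha .$$ 2. Let $\varphi$ be as in 1 and $F>0$. Then $u,w$ are associated displacements if and only if there are constants $C_u,C_w$ such that on $[0,L]$ $$u(x)=C_u-x-\tfrac{2}{bk^2}\mathrm{dn}(a+bx,k)\sin\alpha+\Big(\tfrac{2}{bk^2}E_J(\mathrm{am}(a+bx,k),k)+x-\tfrac{2x}{k^2}\Big)\cos\alpha,$$ $$w(x)=C_w+\tfrac{2}{bk^2}\mathrm{dn}(a+bx,k)\cos\alpha+\Big(\tfrac{2}{bk^2}E_J(\mathrm{am}(a+bx,k),k)+x-\tfrac{2x}{k^2}\Big)\sin\alpha.$$ 3. One has $k>1$ if and only if $2F(1+\cos(\varphi_a+\alpha))>M^2/EI$. In this case put $\tilde k=1/k$, $\tilde a=ka$, $\tilde b=kb$. Then $$\tilde k=\sqrt{\sin^2\tfrac{\varphi_a+\alpha}2+\tfrac{M^2}{4EI\,F}},\quad \tilde a=F_J\Big(\arcsin\big(\tfrac1{\tilde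 k}\sin\tfrac{\varphi_a+\alpha}2\big),\tilde k\Big),\quad \tilde b=s\sqrt{F/EI};$$ $\varphi$ is a rotation without inflexion point on $[0,L]$ if and only if, for all $x\in[0,L]$, $|\tilde a+\tilde bx|\le K(\tilde k)$ and $$\varphi(x)=2\arcsin\big(\tilde k\,\mathrm{sn}(\tilde a+\tilde bx,\tilde k)\big)-\alpha;$$ and for such $\varphi$, $u,w$ are associated displacements if and only if there are constants $C_u,C_w$ such that on $[0,L]$ $$u(x)=C_u-x-\tfrac{2\tilde k}{\tilde b}\mathrm{cn}(\tilde a+\tilde bx,\tilde k)\sin\alpha+\Big(\tfrac{2}{\tilde b}E_J(\mathrm{am}(\tilde a+\tilde bx,\tilde k),\tilde k)-x\Big)\cos\alpha,$$ $$w(x)=C_w+\tfrac{2\tilde k}{\tilde b}\mathrm{cn}(\tilde a+\tilde bx,\tilde k)\cos\alpha+\Big(\tfrac{2}{\tilde b}E_J(\mathrm{am}(\tilde a+\tilde bx,\tilde k),\tilde k)-x\Big)\sin\alpha.$$ -/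

import Mathlib

noncomputable section

namespace InextensibleBeam

/-! ### Elliptic integrals and Jacobi elliptic functions (real, modulus `k ≥ 0`) -/

/-- Incomplete elliptic integral of the first kind. -/
def FJ (ψ k : ℝ) : ℝ := ∫ t in (0 : ℝ)..ψ, 1 / Real.sqrt (1 - k ^ 2 * Real.sin t ^ 2)

/-- Incomplete elliptic integral of the second kind. -/
def EJ (ψ k : ℝ) : ℝ := ∫ t in (0 : ℝ)..ψ, Real.sqrt (1 - k ^ 2 * Real.sin t ^ 2)

/-- Complete elliptic integral of the first kind. -/
def K (k : ℝ) : ℝ := FJ (Real.pi / 2) k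

/-- The set of amplitudes `ψ` for which the real integral `FJ ψ k` makes sense (`k ≥ 0`):
everything for `k < 1`, the open interval `(-π/2, π/2)` for `k = 1` (the integral diverges at
`±π/2`), and `[-arcsin (1/k), arcsin (1/k)]` for `k > 1` (the integrand is real exactly there, and
its endpoint singularity is integrable). -/
def amplitudes (k : ℝ) : Set ℝ :=
  if k < 1 then Set.univ
  else if k = 1 then Set.Ioo (-(Real.pi / 2)) (Real.pi / 2)
  else Set.Icc (-Real.arcsin (1 / k)) (Real.arcsin (1 / k))

/-- The arguments at which the Jacobi functions of modulus `k` are defined: the values of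
`FJ · k`. -/
def arguments (k : ℝ) : Set ℝ := (fun ψ => FJ ψ k) '' amplitudes k

/-- Jacobi amplitude: the inverse of `FJ · k`. -/
def am (y k : ℝ) : ℝ := Function.invFunOn (fun ψ => FJ ψ k) (amplitudes k) y

/-- Elliptic sine. -/
def sn (y k : ℝ) : ℝ := Real.sin (am y k)

/-- Elliptic cosine. -/
def cn (y k : ℝ) : ℝ := Real.cos (am y k)

/-- Delta amplitude. -/
def dn (y k : ℝ) : ℝ := Real.sqrt (1 - k ^ 2 * sn y k ^ 2)

/-! ### Beam data and the constants of the solution -/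

/-- Bending stiffness `EI`, the components `X`, `Z` of the left-end force, the left-end moment `M`
and the left-end rotation `φa`. -/
structure EndData where
  EI : ℝ
  X : ℝ
  Z : ℝ
  M : ℝ
  φa : ℝ

namespace EndData

variable (d : EndData)

/-- Left-end curvature. -/
def κa : ℝ := -d.M / d.EI

/-- Magnitude of the left-end force. -/
def F : ℝ := Real.sqrt (d.X ^ 2 + d.Z ^ 2)

/-- Normal force at the left end. -/
def N : ℝ := -d.X * Real.cos d.φa + d.Z * Real.sin d.φa

def c₁ : ℝ := d.κa ^ 2 + 2 * d.N / d.EI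

def A : ℝ := 2 * d.F / d.EI

/-- The modulus. -/
def k : ℝ := Real.sqrt (2 * d.A / (d.c₁ + d.A))

/-- Sign of the curvature near the left end: the sign of `κa`, or, if `κa = 0`, the sign of
`EI φ''(0) = -(X sin φa + Z cos φa)`. -/
def curvSign : ℝ :=
  if d.κa ≠ 0 then Real.sign d.κa
  else Real.sign (-(d.X * Real.sin d.φa + d.Z * Real.cos d.φa))

/-- `α` is the angle of the end force. It is determined modulo `2π`; for modulus `k ≥ 1`
the representative has to be chosen so that `φa + α` lies in `[-π, π]`. -/
structure IsPhase (α : ℝ) : Prop where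
  cos_eq : d.F * Real.cos α = d.X
  sin_eq : d.F * Real.sin α = d.Z
  branch : 1 ≤ d.k → |d.φa + α| ≤ Real.pi

def a (α : ℝ) : ℝ := FJ ((d.φa + α) / 2) d.k

def b : ℝ := Real.sqrt (d.c₁ + d.A) / 2 * d.curvSign

/-- Reciprocal modulus `k̃`. -/
def ktil : ℝ := 1 / d.k

/-- `ã`. -/
def atil (α : ℝ) : ℝ := d.k * d.a α

/-- `b̃`. -/
def btil : ℝ := d.k * d.b

/-- `φ` solves the rotation equation `EI φ'' + X sin φ + Z cos φ = 0` on `[0, L]`, with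
`φ(0) = φa` and `EI φ'(0) = -M`, and there is no inflexion point: the curvature `κ = φ'` does not
change its sign on `[0, L]` (it may vanish at the ends). -/
def IsRotation (L : ℝ) (φ : ℝ → ℝ) : Prop :=
  ∃ κ κ' : ℝ → ℝ,
    φ 0 = d.φa ∧ κ 0 = -d.M / d.EI ∧
    (∀ x ∈ Set.Icc 0 L, HasDerivWithinAt φ (κ x) (Set.Icc 0 L) x) ∧
    (∀ x ∈ Set.Icc 0 L, HasDerivWithinAt κ (κ' x) (Set.Icc 0 L) x) ∧
    (∀ x ∈ Set.Icc 0 L,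
      d.EI * κ' x + d.X * Real.sin (φ x) + d.Z * Real.cos (φ x) = 0) ∧
    (∀ x ∈ Set.Icc 0 L, ∀ y ∈ Set.Icc 0 L, 0 ≤ κ x * κ y)

end EndData

/-- `u`, `w` are centerline displacements on `[0, L]` of an axially inextensible beam with
rotation `φ`: `u' = cos φ - 1` and `w' = -sin φ`. -/
def IsDisplacement (L : ℝ) (φ u w : ℝ → ℝ) : Prop :=
  ∀ x ∈ Set.Icc 0 L,
    HasDerivWithinAt u (Real.cos (φ x) - 1) (Set.Icc 0 L) x ∧
    HasDerivWithinAt w (-Real.sin (φ x)) (Set.Icc 0 L) x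

end InextensibleBeam

end

open InextensibleBeam

namespace InextensibleBeam

open Real Set

/-! ### Amplitudes -/

/-! With `α` the angle of the end force, the equation becomes the pendulum equation `φ'' = -(F/EI)
sin (φ + α)`. Its first integral `φ'² - A cos (φ + α)`, written for the half angle `θ = (φ + α)/2`,
reads `θ'² = b² (1 - k² sin² θ)`. Without inflexion points the sign of the root is fixed, so `θ' = b
√(1 - k² sin² θ)`, the derivative of `FJ θ k` is `b`, and `θ = am (a + b x)`. The converse follows
from `am' = dn`, `dn' = -k² sn cn` and `b² k² = F/EI`.

The delicate points are where the radicand vanishes. `half_mem_amplitudes` shows that `θ` never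
leaves the amplitudes and meets such points at most at `0` and `L`. For `k > 1` the ends of
`amplitudes k` are genuine singularities of the integrand; `FJ_reciprocal` carries everything over
to the modulus `1/k < 1`, where the Jacobi functions are differentiable on all of `ℝ`. It also
yields the second form of the solution.

For the displacements, `cos φ` and `sin φ` are expanded around the angle `α`; primitives of `sin (φ
+ α)` and `cos (φ + α)` come from `dn` and `EJ ∘ am`. -/

theorem amplitudes_of_lt_one {k : ℝ} (hk : k < 1) : amplitudes k = univ := by
  simp [amplitudes, hk]

theorem mem_amplitudes_of_lt_one {k : ℝ} (hk : k < 1) (ψ : ℝ) : ψ ∈ amplitudes k := by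
  rw [amplitudes_of_lt_one hk]; trivial

theorem amplitudes_one : amplitudes 1 = Ioo (-(π / 2)) (π / 2) := by
  simp [amplitudes]

theorem mem_amplitudes_of_one_lt {k ψ : ℝ} (hk : 1 < k) :
    ψ ∈ amplitudes k ↔ |ψ| ≤ π / 2 ∧ |k * sin ψ| ≤ 1 := by
  have hk0 : 0 < k := by linarith
  have h1 : amplitudes k = Icc (-arcsin (1 / k)) (arcsin (1 / k)) := by
    simp [amplitudes, not_lt.2 hk.le, hk.ne']
  have h2 : |k * sin ψ| ≤ 1 ↔ -(1 / k) ≤ sin ψ ∧ sin ψ ≤ 1 / k := by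
    rw [abs_le, le_div_iff₀ hk0, ← neg_div, div_le_iff₀ hk0, mul_comm]
  have h3 := arcsin_le_pi_div_two (1 / k)
  rw [h1, h2, abs_le, ← arcsin_neg]
  have h4 := neg_pi_div_two_le_arcsin (-(1 / k))
  constructor
  · rintro ⟨h, h'⟩
    have hm : ψ ∈ Icc (-(π / 2)) (π / 2) := ⟨h4.trans h, h'.trans h3⟩
    exact ⟨hm, (arcsin_le_iff_le_sin' ⟨hm.1, lt_of_le_of_lt h' (by
      refine arcsin_lt_pi_div_two.2 ?_
      rw [div_lt_one hk0]; exact hk)⟩).1 h, (le_arcsin_iff_sin_le' ⟨lt_of_lt_of_le (by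
      refine neg_pi_div_two_lt_arcsin.2 ?_
      rw [neg_lt_neg_iff, div_lt_one hk0]; exact hk) h, hm.2⟩).1 h'⟩
  · rintro ⟨hm, h, h'⟩
    have hs1 : 1 / k ≤ 1 := by rw [div_le_one hk0]; exact hk.le
    have hs0 : 0 < 1 / k := by positivity
    exact ⟨(arcsin_le_iff_le_sin ⟨by linarith, by linarith⟩ hm).2 h,
      (le_arcsin_iff_sin_le hm ⟨by linarith, by linarith⟩).2 h'⟩

theorem ordConnected_amplitudes (k : ℝ) : (amplitudes k).OrdConnected := by
  unfold amplitudes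
  split_ifs
  · exact ordConnected_univ
  · exact ordConnected_Ioo
  · exact ordConnected_Icc

theorem isOpen_amplitudes {k : ℝ} (hk : k ≤ 1) : IsOpen (amplitudes k) := by
  rcases hk.lt_or_eq with h | rfl
  · simp [amplitudes_of_lt_one h]
  · rw [amplitudes_one]; exact isOpen_Ioo

theorem radicand_pos {k ψ : ℝ} (hk0 : 0 ≤ k) (hk : k ≤ 1) (hψ : ψ ∈ amplitudes k) :
    0 < 1 - k ^ 2 * sin ψ ^ 2 := by
  rcases hk.lt_or_eq with h | rfl
  · have := sin_sq_le_one ψ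
    nlinarith [sq_nonneg (sin ψ)]
  · rw [amplitudes_one] at hψ
    have := cos_pos_of_mem_Ioo hψ
    have := sin_sq_add_cos_sq ψ
    nlinarith

theorem radicand_nonneg {k ψ : ℝ} (hk0 : 0 ≤ k) (hψ : ψ ∈ amplitudes k) :
    0 ≤ 1 - k ^ 2 * sin ψ ^ 2 := by
  rcases le_or_gt k 1 with h | h
  · exact (radicand_pos hk0 h hψ).le
  · have := (sq_le_one_iff_abs_le_one _).2 ((mem_amplitudes_of_one_lt h).1 hψ).2
    nlinarith

theorem abs_le_pi_div_two_of_mem_amplitudes {k ψ : ℝ} (hk : 1 ≤ k) (hψ : ψ ∈ amplitudes k) :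
    |ψ| ≤ π / 2 := by
  rcases hk.lt_or_eq with h | rfl
  · exact ((mem_amplitudes_of_one_lt h).1 hψ).1
  · rw [amplitudes_one] at hψ
    exact abs_le.2 ⟨hψ.1.le, hψ.2.le⟩

theorem sin_sq_le_sin_sq_of_abs_le {s t : ℝ} (hst : |s| ≤ |t|) (ht : |t| ≤ π / 2) :
    sin s ^ 2 ≤ sin t ^ 2 := by
  rw [← sq_abs (sin s), ← sq_abs (sin t), abs_sin_eq_sin_abs_of_abs_le_pi (by linarith [pi_pos]),
    abs_sin_eq_sin_abs_of_abs_le_pi (by linarith [pi_pos])]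
  have h0 : 0 ≤ sin |s| := sin_nonneg_of_nonneg_of_le_pi (abs_nonneg _) (by linarith [pi_pos])
  have : sin |s| ≤ sin |t| :=
    sin_le_sin_of_le_of_le_pi_div_two (by linarith [abs_nonneg s, pi_pos]) ht hst
  gcongr

/-- The radicand is positive between `0` and a point of positivity. -/
theorem radicand_pos_of_mem_uIcc {k ψ t : ℝ} (hk0 : 0 ≤ k) (hψ : ψ ∈ amplitudes k)
    (hpos : 0 < 1 - k ^ 2 * sin ψ ^ 2) (ht : t ∈ uIcc 0 ψ) :
    0 < 1 - k ^ 2 * sin t ^ 2 := by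
  rcases lt_or_ge k 1 with h | h
  · exact radicand_pos hk0 h.le (mem_amplitudes_of_lt_one h _)
  · have h1 : |t| ≤ |ψ| := by simpa using abs_sub_left_of_mem_uIcc ht
    have h2 := sin_sq_le_sin_sq_of_abs_le h1 (abs_le_pi_div_two_of_mem_amplitudes h hψ)
    nlinarith [sq_nonneg k]

/-! ### The elliptic integrals -/

theorem FJ_neg (ψ k : ℝ) : FJ (-ψ) k = -FJ ψ k := by
  have h := intervalIntegral.integral_comp_neg (a := 0) (b := ψ)
    (fun t => 1 / sqrt (1 - k ^ 2 * sin t ^ 2))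
  simp only [sin_neg, neg_sq, neg_zero] at h
  rw [FJ, FJ, h, intervalIntegral.integral_symm]

/-- Strictness is what the inverse function rule for `am` needs. The positivity hypothesis leaves
out the ends of `amplitudes k` when `k > 1`. -/
theorem hasStrictDerivAt_FJ {k ψ : ℝ} (hk0 : 0 ≤ k) (hψ : ψ ∈ amplitudes k)
    (hpos : 0 < 1 - k ^ 2 * sin ψ ^ 2) :
    HasStrictDerivAt (fun ψ => FJ ψ k) (1 / sqrt (1 - k ^ 2 * sin ψ ^ 2)) ψ := by
  have hc : ∀ t, 0 < 1 - k ^ 2 * sin t ^ 2 →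
      ContinuousAt (fun t => 1 / sqrt (1 - k ^ 2 * sin t ^ 2)) t := fun t ht =>
    ContinuousAt.div (by fun_prop) (by fun_prop) (sqrt_pos.2 ht).ne'
  refine intervalIntegral.integral_hasStrictDerivAt_right ?_ ?_ (hc ψ hpos)
  · refine ContinuousOn.intervalIntegrable fun t ht => ?_
    exact (hc t (radicand_pos_of_mem_uIcc hk0 hψ hpos ht)).continuousWithinAt
  · have : Measurable (fun t => 1 / sqrt (1 - k ^ 2 * sin t ^ 2)) := by fun_prop
    exact this.stronglyMeasurable.stronglyMeasurableAtFilter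

theorem hasDerivAt_EJ (ψ k : ℝ) :
    HasDerivAt (fun ψ => EJ ψ k) (sqrt (1 - k ^ 2 * sin ψ ^ 2)) ψ := by
  have hc : Continuous (fun t => sqrt (1 - k ^ 2 * sin t ^ 2)) := by fun_prop
  exact hc.integral_hasStrictDerivAt 0 ψ |>.hasDerivAt

theorem continuousOn_FJ_of_le_one {k : ℝ} (hk0 : 0 ≤ k) (hk : k ≤ 1) :
    ContinuousOn (fun ψ => FJ ψ k) (amplitudes k) := fun _ hψ =>
  (hasStrictDerivAt_FJ hk0 hψ (radicand_pos hk0 hk hψ)).hasDerivAt.continuousAt.continuousWithinAt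

theorem strictMonoOn_FJ_of_le_one {k : ℝ} (hk0 : 0 ≤ k) (hk : k ≤ 1) :
    StrictMonoOn (fun ψ => FJ ψ k) (amplitudes k) := by
  refine strictMonoOn_of_deriv_pos (ordConnected_amplitudes k).convex
    (continuousOn_FJ_of_le_one hk0 hk) fun ψ hψ => ?_
  have hp := radicand_pos hk0 hk (interior_subset hψ)
  rw [(hasStrictDerivAt_FJ hk0 (interior_subset hψ) hp).hasDerivAt.deriv]
  exact one_div_pos.2 (sqrt_pos.2 hp)

theorem one_div_lt_one_of_one_lt {k : ℝ} (hk : 1 < k) : 1 / k < 1 := by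
  rw [div_lt_one (by linarith)]; exact hk

/-- Reciprocal modulus transformation. -/
theorem FJ_reciprocal {k ψ : ℝ} (hk : 1 < k) (hψ : ψ ∈ amplitudes k) :
    k * FJ ψ k = FJ (arcsin (k * sin ψ)) (1 / k) := by
  have hk0 : 0 < k := by linarith
  have hk1 := one_div_lt_one_of_one_lt hk
  have hk1' : 0 ≤ 1 / k := by positivity
  have hkt := mem_amplitudes_of_lt_one hk1
  have hcont : ContinuousOn (fun t => FJ (arcsin (k * sin t)) (1 / k)) (uIcc 0 ψ) := by
    have : Continuous (fun t => FJ t (1 / k)) := by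
      have h := continuousOn_FJ_of_le_one hk1' hk1.le
      rwa [amplitudes_of_lt_one hk1, continuousOn_univ] at h
    exact (this.comp (by fun_prop)).continuousOn
  have hsub : ∀ t ∈ Ioo (min 0 ψ) (max 0 ψ), |t| < |ψ| := by
    rintro t ⟨h1, h2⟩
    rcases le_total 0 ψ with h | h
    · simp only [h, min_eq_left, max_eq_right] at h1 h2
      rwa [abs_of_pos h1, abs_of_nonneg h]
    · simp only [h, min_eq_right, max_eq_left] at h1 h2
      rw [abs_of_neg h2, abs_of_nonpos h]; linarith
  obtain ⟨hψ1, hψ2⟩ := (mem_amplitudes_of_one_lt hk).1 hψ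
  have hψ2' := (sq_le_one_iff_abs_le_one _).2 hψ2
  have hderiv : ∀ t ∈ Ioo (min 0 ψ) (max 0 ψ),
      HasDerivAt (fun t => FJ (arcsin (k * sin t)) (1 / k))
        (k * (1 / sqrt (1 - k ^ 2 * sin t ^ 2))) t := by
    intro t ht
    have ht1 := hsub t ht
    have hcos : 0 < cos t := cos_pos_of_mem_Ioo (abs_lt.1 (ht1.trans_le hψ1))
    have hr : 0 < 1 - k ^ 2 * sin t ^ 2 := by
      have hlt : sin t ^ 2 < sin ψ ^ 2 := by
        rw [← sq_abs (sin t), ← sq_abs (sin ψ),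
          abs_sin_eq_sin_abs_of_abs_le_pi (by linarith [pi_pos]),
          abs_sin_eq_sin_abs_of_abs_le_pi (by linarith [pi_pos])]
        have h0 : 0 ≤ sin |t| :=
          sin_nonneg_of_nonneg_of_le_pi (abs_nonneg _) (by linarith [pi_pos])
        have : sin |t| < sin |ψ| :=
          sin_lt_sin_of_lt_of_le_pi_div_two (by linarith [abs_nonneg t, pi_pos]) hψ1 ht1
        gcongr
      have : 0 < k ^ 2 := by positivity
      nlinarith
    have hb : |k * sin t| < 1 := by
      rw [← sq_lt_one_iff_abs_lt_one]; nlinarith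
    have hb' := abs_lt.1 hb
    have harc := (hasDerivAt_arcsin hb'.1.ne' hb'.2.ne).comp t ((hasDerivAt_sin t).const_mul k)
    have hsin : sin (arcsin (k * sin t)) = k * sin t := sin_arcsin hb'.1.le hb'.2.le
    -- The radicand of modulus `1/k` becomes `cos² t`, which cancels the factor `cos t` produced by
    -- differentiating `k sin t`.
    have hcs : 1 - (1 / k) ^ 2 * sin (arcsin (k * sin t)) ^ 2 = cos t ^ 2 := by
      rw [hsin, cos_sq']; field_simp
    have hF := (hasStrictDerivAt_FJ hk1' (hkt (arcsin (k * sin t)))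
      (by rw [hcs]; positivity)).hasDerivAt
    rw [hcs, sqrt_sq hcos.le] at hF
    have := hF.comp t harc
    refine this.congr_deriv ?_
    rw [mul_pow]
    have := (sqrt_pos.2 hr).ne'
    field_simp
  -- The integrand may blow up at `ψ`; it is integrable as the nonnegative derivative of a function
  -- continuous up to the ends.
  have hint := intervalIntegral.intervalIntegrable_deriv_of_nonneg hcont hderiv (by
    intro t _; positivity)
  have := intervalIntegral.integral_eq_sub_of_hasDeriv_right hcont
    (fun t ht => (hderiv t ht).hasDerivWithinAt) hint
  rw [intervalIntegral.integral_const_mul] at this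
  simpa [FJ] using this

theorem strictMonoOn_FJ {k : ℝ} (hk0 : 0 ≤ k) :
    StrictMonoOn (fun ψ => FJ ψ k) (amplitudes k) := by
  rcases le_or_gt k 1 with h | h
  · exact strictMonoOn_FJ_of_le_one hk0 h
  have h1 := one_div_lt_one_of_one_lt h
  intro s hs t ht hst
  have hm := strictMonoOn_FJ_of_le_one (k := 1 / k) (by positivity) h1.le
  rw [amplitudes_of_lt_one h1] at hm
  obtain ⟨hs1, hs2⟩ := (mem_amplitudes_of_one_lt h).1 hs
  obtain ⟨ht1, ht2⟩ := (mem_amplitudes_of_one_lt h).1 ht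
  rw [abs_le] at hs1 ht1 hs2 ht2
  have hsin : sin s < sin t := sin_lt_sin_of_lt_of_le_pi_div_two hs1.1 ht1.2 hst
  have harc : arcsin (k * sin s) < arcsin (k * sin t) :=
    strictMonoOn_arcsin hs2 ht2 (by nlinarith)
  have := hm (mem_univ _) (mem_univ _) harc
  simp only [← FJ_reciprocal h hs, ← FJ_reciprocal h ht] at this
  exact lt_of_mul_lt_mul_left this hk0

/-- For `k > 1` the reciprocal formula gives continuity up to the singular ends. -/
theorem continuousOn_FJ {k : ℝ} (hk0 : 0 ≤ k) :
    ContinuousOn (fun ψ => FJ ψ k) (amplitudes k) := by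
  rcases le_or_gt k 1 with h | h
  · exact continuousOn_FJ_of_le_one hk0 h
  have h1 := one_div_lt_one_of_one_lt h
  have hc := continuousOn_FJ_of_le_one (k := 1 / k) (by positivity) h1.le
  rw [amplitudes_of_lt_one h1, continuousOn_univ] at hc
  have hc' : Continuous fun ψ => 1 / k * FJ (arcsin (k * sin ψ)) (1 / k) :=
    continuous_const.mul (hc.comp (by fun_prop))
  refine hc'.continuousOn.congr fun ψ hψ => ?_
  have : k ≠ 0 := by linarith
  simp only [← FJ_reciprocal h hψ]
  field_simp

/-! ### The Jacobi functions -/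

theorem am_mem {k y : ℝ} (hy : y ∈ arguments k) : am y k ∈ amplitudes k :=
  Function.invFunOn_mem hy

theorem FJ_am {k y : ℝ} (hy : y ∈ arguments k) : FJ (am y k) k = y :=
  Function.invFunOn_eq hy

theorem am_FJ {k ψ : ℝ} (hk0 : 0 ≤ k) (hψ : ψ ∈ amplitudes k) : am (FJ ψ k) k = ψ :=
  (strictMonoOn_FJ hk0).injOn.leftInvOn_invFunOn hψ

theorem mem_arguments_reciprocal {k y : ℝ} (hk : 1 < k) :
    y ∈ arguments k ↔ |k * y| ≤ K (1 / k) := by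
  have hk0 : 0 < k := by linarith
  have h1 := one_div_lt_one_of_one_lt hk
  have hm := strictMonoOn_FJ_of_le_one (k := 1 / k) (by positivity) h1.le
  have hc := continuousOn_FJ_of_le_one (k := 1 / k) (by positivity) h1.le
  rw [amplitudes_of_lt_one h1] at hm hc
  constructor
  · rintro ⟨ψ, hψ, rfl⟩
    simp only
    rw [FJ_reciprocal hk hψ, abs_le, K, ← FJ_neg]
    exact ⟨hm.monotoneOn (mem_univ _) (mem_univ _) (neg_pi_div_two_le_arcsin _),
      hm.monotoneOn (mem_univ _) (mem_univ _) (arcsin_le_pi_div_two _)⟩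
  · intro h
    rw [abs_le, K, ← FJ_neg] at h
    -- `χ` is the amplitude of `k y` for the modulus `1/k`; the amplitude of `y` for `k` is then
    -- `arcsin (sin χ / k)`.
    obtain ⟨χ, hχ, hχy⟩ := intermediate_value_Icc (by linarith [pi_pos])
      (hc.mono (subset_univ (Icc (-(π / 2)) (π / 2)))) h
    have hs : |1 / k * sin χ| ≤ 1 := by
      rw [abs_mul, abs_of_pos (by positivity : 0 < 1 / k)]
      nlinarith [abs_sin_le_one χ, abs_nonneg (sin χ)]
    have hs' := abs_le.1 hs
    have hψ : arcsin (1 / k * sin χ) ∈ amplitudes k := by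
      rw [mem_amplitudes_of_one_lt hk, sin_arcsin hs'.1 hs'.2]
      refine ⟨abs_le.2 (arcsin_mem_Icc _), ?_⟩
      rw [← mul_assoc, mul_one_div_cancel hk0.ne', one_mul]
      exact abs_sin_le_one χ
    refine ⟨_, hψ, ?_⟩
    have := FJ_reciprocal hk hψ
    rw [sin_arcsin hs'.1 hs'.2, ← mul_assoc, mul_one_div_cancel hk0.ne', one_mul,
      arcsin_sin hχ.1 hχ.2] at this
    simp only at hχy ⊢
    rw [hχy] at this
    exact mul_left_cancel₀ hk0.ne' this

theorem mul_mem_arguments_reciprocal {k y : ℝ} (hk : 1 < k) (hy : y ∈ arguments k) :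
    k * y ∈ arguments (1 / k) := by
  refine ⟨arcsin (k * sin (am y k)),
    mem_amplitudes_of_lt_one (one_div_lt_one_of_one_lt hk) _, ?_⟩
  simp only
  rw [← FJ_reciprocal hk (am_mem hy), FJ_am hy]

theorem am_reciprocal {k y : ℝ} (hk : 1 < k) (hy : y ∈ arguments k) :
    am (k * y) (1 / k) = arcsin (k * sn y k) := by
  have h1 := one_div_lt_one_of_one_lt hk
  rw [sn, ← am_FJ (k := 1 / k) (ψ := arcsin (k * sin (am y k))) (by positivity)
    (mem_amplitudes_of_lt_one h1 _), ← FJ_reciprocal hk (am_mem hy), FJ_am hy]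

theorem sn_reciprocal {k y : ℝ} (hk : 1 < k) (hy : y ∈ arguments k) :
    sn (k * y) (1 / k) = k * sn y k := by
  have h := abs_le.1 ((mem_amplitudes_of_one_lt hk).1 (am_mem hy)).2
  rw [sn, am_reciprocal hk hy]
  exact sin_arcsin h.1 h.2

theorem cn_reciprocal {k y : ℝ} (hk : 1 < k) (hy : y ∈ arguments k) :
    cn (k * y) (1 / k) = dn y k := by
  rw [cn, am_reciprocal hk hy, cos_arcsin, dn, mul_pow]

theorem cn_nonneg_of_one_le {k y : ℝ} (hk : 1 ≤ k) (hy : y ∈ arguments k) : 0 ≤ cn y k :=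
  cos_nonneg_of_mem_Icc (abs_le.1 (abs_le_pi_div_two_of_mem_amplitudes hk (am_mem hy)))

theorem dn_reciprocal {k y : ℝ} (hk : 1 < k) (hy : y ∈ arguments k) :
    dn (k * y) (1 / k) = cn y k := by
  have hk0 : k ≠ 0 := by linarith
  have : 1 - (1 / k) ^ 2 * (k * sn y k) ^ 2 = cn y k ^ 2 := by
    rw [cn, cos_sq', sn]; field_simp
  rw [dn, sn_reciprocal hk hy, this, sqrt_sq (cn_nonneg_of_one_le hk.le hy)]

/-- The argument of `arcsin` is at most `1/k < 1` in absolute value, so the right side is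
differentiable even at the ends of `arguments k`, where `FJ` cannot be inverted by its derivative.
-/
theorem am_eq_arcsin_reciprocal {k y : ℝ} (hk : 1 < k) (hy : y ∈ arguments k) :
    am y k = arcsin (1 / k * sn (k * y) (1 / k)) := by
  have hk0 : k ≠ 0 := by linarith
  have h := abs_le.1 ((mem_amplitudes_of_one_lt hk).1 (am_mem hy)).1
  rw [sn_reciprocal hk hy, ← mul_assoc, one_div_mul_cancel hk0, one_mul, sn, arcsin_sin h.1 h.2]

theorem dn_sq {k y : ℝ} (hk0 : 0 ≤ k) (hy : y ∈ arguments k) :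
    dn y k ^ 2 = 1 - k ^ 2 * sn y k ^ 2 :=
  sq_sqrt (radicand_nonneg hk0 (am_mem hy))

theorem hasDerivAt_am_of_le_one {k y : ℝ} (hk0 : 0 ≤ k) (hk : k ≤ 1) (hy : y ∈ arguments k) :
    HasDerivAt (fun y => am y k) (dn y k) y := by
  obtain ⟨ψ, hψ, rfl⟩ := hy
  have hp := radicand_pos hk0 hk hψ
  have h := (hasStrictDerivAt_FJ hk0 hψ hp).to_local_left_inverse
    (one_div_pos.2 (sqrt_pos.2 hp)).ne' (g := fun y => am y k)
    (by filter_upwards [(isOpen_amplitudes hk).mem_nhds hψ] with t ht using am_FJ hk0 ht)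
  refine h.hasDerivAt.congr_deriv ?_
  rw [dn, sn, am_FJ hk0 hψ, one_div, inv_inv]

theorem hasDerivWithinAt_am {k y : ℝ} (hk0 : 0 ≤ k) (hy : y ∈ arguments k) :
    HasDerivWithinAt (fun y => am y k) (dn y k) (arguments k) y := by
  rcases le_or_gt k 1 with h | h
  · exact (hasDerivAt_am_of_le_one hk0 h hy).hasDerivWithinAt
  have h1 := one_div_lt_one_of_one_lt h
  have hkne : k ≠ 0 := by linarith
  have hin := hasDerivAt_am_of_le_one (k := 1 / k) (by positivity) h1.le
    (mul_mem_arguments_reciprocal h hy)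
  have hin' : HasDerivAt (fun y => 1 / k * sn (k * y) (1 / k))
      (1 / k * (cn (k * y) (1 / k) * (dn (k * y) (1 / k) * (k * 1)))) y :=
    ((HasDerivAt.comp y hin ((hasDerivAt_id y).const_mul k)).sin).const_mul (1 / k)
  have hval : 1 / k * sn (k * y) (1 / k) = sn y k := by
    rw [sn_reciprocal h hy]; field_simp
  have hsn : sn y k ^ 2 < 1 := by
    have := dn_sq hk0 hy
    have := sq_nonneg (dn y k)
    have : 1 < k ^ 2 := by nlinarith
    nlinarith [sq_nonneg (sn y k)]
  have hsn' := abs_lt.1 ((sq_lt_one_iff_abs_lt_one _).1 hsn)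
  have harc := hasDerivAt_arcsin hsn'.1.ne' hsn'.2.ne
  rw [← hval] at harc
  have hcomp := (HasDerivAt.comp y harc hin').hasDerivWithinAt (s := arguments k)
  refine (hcomp.congr (fun z hz => am_eq_arcsin_reciprocal h hz)
    (am_eq_arcsin_reciprocal h hy)).congr_deriv ?_
  have hcn : sqrt (1 - sn y k ^ 2) = cn y k := by
    rw [← sqrt_sq (cn_nonneg_of_one_le h.le hy), cn, cos_sq', sn]
  have hcn0 : cn y k ≠ 0 := by
    rw [← hcn]; exact (sqrt_pos.2 (by linarith)).ne'
  rw [hval, hcn, cn_reciprocal h hy, dn_reciprocal h hy]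
  field_simp

/-- For `k > 1` the radicand vanishes at the ends and the square root cannot be differentiated
there; `dn` is replaced by `cn (k y) (1/k)`. -/
theorem hasDerivWithinAt_dn {k y : ℝ} (hk0 : 0 ≤ k) (hy : y ∈ arguments k) :
    HasDerivWithinAt (fun y => dn y k) (-(k ^ 2 * sn y k * cn y k)) (arguments k) y := by
  rcases le_or_gt k 1 with h | h
  · have hp := radicand_pos hk0 h (am_mem hy)
    have h1 := (((hasDerivAt_am_of_le_one hk0 h hy).sin.pow 2).const_mul (k ^ 2)).const_sub 1
    have h2 := h1.sqrt hp.ne'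
    refine (h2.congr_deriv ?_).hasDerivWithinAt
    have hd : sqrt (1 - k ^ 2 * sin (am y k) ^ 2) = dn y k := rfl
    have hd0 : dn y k ≠ 0 := by rw [← hd]; exact (sqrt_pos.2 hp).ne'
    simp only [Pi.pow_apply]
    rw [hd, sn, cn]
    field_simp
    norm_num
    ring
  · have h1 := one_div_lt_one_of_one_lt h
    have hin := hasDerivAt_am_of_le_one (k := 1 / k) (by positivity) h1.le
      (mul_mem_arguments_reciprocal h hy)
    have hin' : HasDerivAt (fun y => cn (k * y) (1 / k))
        (-sn (k * y) (1 / k) * (dn (k * y) (1 / k) * (k * 1))) y :=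
      (HasDerivAt.comp y hin ((hasDerivAt_id y).const_mul k)).cos
    refine (hin'.hasDerivWithinAt.congr (fun z hz => (cn_reciprocal h hz).symm)
      (cn_reciprocal h hy).symm).congr_deriv ?_
    rw [sn_reciprocal h hy, dn_reciprocal h hy]
    ring

theorem hasDerivWithinAt_EJ_am {k y : ℝ} (hk0 : 0 ≤ k) (hy : y ∈ arguments k) :
    HasDerivWithinAt (fun y => EJ (am y k) k) (dn y k ^ 2) (arguments k) y := by
  have := (hasDerivAt_EJ (am y k) k).comp_hasDerivWithinAt y (hasDerivWithinAt_am hk0 hy)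
  exact this.congr_deriv (sq (dn y k)).symm

end InextensibleBeam

namespace InextensibleBeam.EndData

open Real Set

/-! ### Relations between the constants -/

variable {d : EndData} {α L : ℝ} {φ : ℝ → ℝ}

theorem sin_eq_two_mul_sin_half_mul_cos_half (x : ℝ) :
    sin x = 2 * sin (x / 2) * cos (x / 2) := by
  rw [← sin_two_mul, mul_div_cancel₀ x (two_ne_zero' ℝ)]

theorem cos_eq_one_sub_two_mul_sin_half_sq (x : ℝ) : cos x = 1 - 2 * sin (x / 2) ^ 2 := by
  have h := cos_two_mul' (x / 2)
  rw [mul_div_cancel₀ x (two_ne_zero' ℝ), cos_sq'] at h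
  linarith

theorem F_nonneg (d : EndData) : 0 ≤ d.F := sqrt_nonneg _

theorem F_sq (d : EndData) : d.F ^ 2 = d.X ^ 2 + d.Z ^ 2 := sq_sqrt (by positivity)

theorem k_nonneg (d : EndData) : 0 ≤ d.k := sqrt_nonneg _

theorem exists_isPhase (d : EndData) : ∃ α, d.IsPhase α := by
  rcases d.F_nonneg.eq_or_lt with hF | hF
  · have h := d.F_sq
    rw [← hF] at h
    have hX : d.X = 0 := by nlinarith [sq_nonneg d.X, sq_nonneg d.Z]
    have hZ : d.Z = 0 := by nlinarith [sq_nonneg d.X, sq_nonneg d.Z]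
    -- Without force `k = 0`, so the branch condition is void and any angle would do.
    refine ⟨0, by simp [← hF, hX], by simp [hZ], fun hk => ?_⟩
    have : d.k = 0 := by simp [k, A, ← hF]
    linarith
  · set z : ℂ := ⟨d.X, d.Z⟩ with hz
    have hnorm : ‖z‖ = d.F := by
      rw [Complex.norm_eq_sqrt_sq_add_sq, F]
    have hz0 : z ≠ 0 := by
      rw [← norm_pos_iff, hnorm]; exact hF
    have hmod := toIocMod_mem_Ioc two_pi_pos (-π) (d.φa + z.arg)
    have hself : toIocMod two_pi_pos (-π) (d.φa + z.arg) - d.φa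
        = z.arg - toIocDiv two_pi_pos (-π) (d.φa + z.arg) * (2 * π) := by
      rw [toIocMod, zsmul_eq_mul]; ring
    refine ⟨toIocMod two_pi_pos (-π) (d.φa + z.arg) - d.φa, ?_, ?_, fun _ => ?_⟩
    · rw [hself, cos_sub_int_mul_two_pi, Complex.cos_arg hz0, hnorm]
      exact mul_div_cancel₀ _ hF.ne'
    · rw [hself, sin_sub_int_mul_two_pi, Complex.sin_arg, hnorm]
      exact mul_div_cancel₀ _ hF.ne'
    · rw [add_sub_cancel, abs_le]
      exact ⟨hmod.1.le, by linarith [hmod.2]⟩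

theorem isPhase_arctan (hX : 0 < d.X)
    (h : 1 ≤ d.k → |d.φa + arctan (d.Z / d.X)| ≤ π) : d.IsPhase (arctan (d.Z / d.X)) := by
  have hF : 0 < d.F := sqrt_pos.2 (by positivity)
  have hs : sqrt (1 + (d.Z / d.X) ^ 2) = d.F / d.X := by
    rw [sqrt_eq_iff_mul_self_eq_of_pos (by positivity), ← sq, div_pow, F_sq]
    field_simp
  refine ⟨?_, ?_, h⟩
  · rw [cos_arctan, hs]; field_simp
  · rw [sin_arctan, hs]; field_simp

theorem IsPhase.force_eq (hα : d.IsPhase α) (x : ℝ) :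
    d.X * sin x + d.Z * cos x = d.F * sin (x + α) := by
  rw [← hα.cos_eq, ← hα.sin_eq, sin_add]; ring

/-- Both summands are nonnegative for `EI > 0`; they vanish together only in the excluded case of
constant rotation. -/
theorem IsPhase.c₁_add_A (hα : d.IsPhase α) :
    d.c₁ + d.A = d.κa ^ 2 + 2 * d.A * sin ((d.φa + α) / 2) ^ 2 := by
  have hN : d.N = -d.F * cos (d.φa + α) := by
    rw [N, ← hα.cos_eq, ← hα.sin_eq, cos_add]; ring
  rw [c₁, A, hN, cos_eq_one_sub_two_mul_sin_half_sq]; ring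

theorem A_nonneg (hEI : 0 < d.EI) : 0 ≤ d.A := div_nonneg (by linarith [d.F_nonneg]) hEI.le

theorem κa_eq_zero_iff (hEI : 0 < d.EI) : d.κa = 0 ↔ d.M = 0 := by
  simp [κa, hEI.ne']

theorem c₁_add_A_pos (hEI : 0 < d.EI)
    (hd : d.M ≠ 0 ∨ d.X * sin d.φa + d.Z * cos d.φa ≠ 0) : 0 < d.c₁ + d.A := by
  obtain ⟨α, hα⟩ := d.exists_isPhase
  have hA := A_nonneg hEI
  rw [hα.c₁_add_A]
  by_contra! h
  have h1 : d.κa = 0 := by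
    nlinarith [sq_nonneg d.κa, mul_nonneg hA (sq_nonneg (sin ((d.φa + α) / 2)))]
  have h2 : d.A * sin ((d.φa + α) / 2) ^ 2 = 0 := by
    nlinarith [sq_nonneg d.κa, mul_nonneg hA (sq_nonneg (sin ((d.φa + α) / 2)))]
  rcases hd with hd | hd
  · exact hd ((κa_eq_zero_iff hEI).1 h1)
  · apply hd
    rw [hα.force_eq, sin_eq_two_mul_sin_half_mul_cos_half]
    rcases mul_eq_zero.1 h2 with h | h
    · have : d.F = 0 := by
        rw [A, div_eq_zero_iff] at h
        rcases h with h | h <;> linarith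
      rw [this, zero_mul]
    · rw [pow_eq_zero_iff two_ne_zero] at h
      rw [h]; ring

theorem k_sq_mul (hEI : 0 < d.EI) (hc : 0 < d.c₁ + d.A) : d.k ^ 2 * (d.c₁ + d.A) = 2 * d.A := by
  rw [k, sq_sqrt (div_nonneg (by linarith [A_nonneg hEI]) hc.le)]
  field_simp

theorem k_eq (hEI : 0 < d.EI) :
    d.k = sqrt (4 * d.F / (2 * (d.F + d.N) + d.EI * d.κa ^ 2)) := by
  have h1 : 2 * (d.F + d.N) + d.EI * d.κa ^ 2 = d.EI * (d.c₁ + d.A) := by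
    rw [c₁, A]; field_simp; ring
  have h2 : 4 * d.F = d.EI * (2 * d.A) := by rw [A]; field_simp; ring
  rw [k, h1, h2, mul_div_mul_left _ _ hEI.ne']

theorem curvSign_sq (hEI : 0 < d.EI)
    (hd : d.M ≠ 0 ∨ d.X * sin d.φa + d.Z * cos d.φa ≠ 0) : d.curvSign ^ 2 = 1 := by
  have hs : ∀ x : ℝ, x ≠ 0 → Real.sign x ^ 2 = 1 := fun x hx => by
    rcases sign_apply_eq_of_ne_zero x hx with h | h <;> rw [h] <;> norm_num
  rw [curvSign]
  split_ifs with h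
  · exact hs _ h
  · have hM := (κa_eq_zero_iff hEI).1 (not_not.1 h)
    exact hs _ (neg_ne_zero.2 (hd.resolve_left (not_not.2 hM)))

theorem curvSign_mul_κa (d : EndData) : d.curvSign * d.κa = |d.κa| := by
  rw [curvSign]
  split_ifs with h
  · rcases lt_or_gt_of_ne h with h | h
    · rw [sign_of_neg h, abs_of_neg h]; ring
    · rw [sign_of_pos h, abs_of_pos h]; ring
  · rw [not_not.1 h]; simp

theorem b_sq (hs : d.curvSign ^ 2 = 1) (hc : 0 < d.c₁ + d.A) : 4 * d.b ^ 2 = d.c₁ + d.A := by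
  rw [b, mul_pow, hs, div_pow, sq_sqrt hc.le]; ring

theorem b_ne_zero (hs : d.curvSign ^ 2 = 1) (hc : 0 < d.c₁ + d.A) : d.b ≠ 0 := by
  intro h
  have := b_sq hs hc
  rw [h] at this
  linarith

theorem b_sq_mul_k_sq (hEI : 0 < d.EI) (hs : d.curvSign ^ 2 = 1) (hc : 0 < d.c₁ + d.A) :
    d.b ^ 2 * d.k ^ 2 = d.F / d.EI := by
  have h1 := k_sq_mul hEI hc
  rw [← b_sq hs hc, A] at h1
  have : d.b ^ 2 * d.k ^ 2 = (2 * (2 * d.F / d.EI)) / 4 := by linarith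
  rw [this]; ring

/-- The right side is the value of `φ'²` that conservation of `φ'² - A cos (φ + α)` predicts at half
angle `θ`. -/
theorem IsPhase.energy (hα : d.IsPhase α) (hEI : 0 < d.EI) (hs : d.curvSign ^ 2 = 1)
    (hc : 0 < d.c₁ + d.A) (θ : ℝ) :
    4 * d.b ^ 2 * (1 - d.k ^ 2 * sin θ ^ 2)
      = d.κa ^ 2 + 2 * d.A * (sin ((d.φa + α) / 2) ^ 2 - sin θ ^ 2) := by
  have h1 := k_sq_mul hEI hc
  rw [b_sq hs hc]
  have h2 := hα.c₁_add_A
  linear_combination h2 - sin θ ^ 2 * h1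

/-- A solution of the energy equation whose direction is given by `curvSign`. -/
theorem eq_of_sq_eq (hs : d.curvSign ^ 2 = 1) (hc : 0 < d.c₁ + d.A) {κ r : ℝ}
    (hκ : 0 ≤ d.curvSign * κ) (h : κ ^ 2 = 4 * d.b ^ 2 * r) : κ = 2 * d.b * sqrt r := by
  have h1 : d.curvSign * κ = sqrt ((d.c₁ + d.A) * r) := by
    rw [← b_sq hs hc, ← h, ← one_mul (κ ^ 2), ← hs, ← mul_pow, sqrt_sq hκ]
  rw [sqrt_mul hc.le] at h1
  calc κ = d.curvSign * (d.curvSign * κ) := by rw [← mul_assoc, ← sq, hs, one_mul]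
    _ = _ := by rw [h1, b]; ring

theorem IsPhase.κa_eq (hα : d.IsPhase α) (hEI : 0 < d.EI) (hs : d.curvSign ^ 2 = 1)
    (hc : 0 < d.c₁ + d.A) :
    d.κa = 2 * d.b * sqrt (1 - d.k ^ 2 * sin ((d.φa + α) / 2) ^ 2) := by
  refine eq_of_sq_eq hs hc (by rw [curvSign_mul_κa]; positivity) ?_
  rw [hα.energy hEI hs hc]; ring

theorem one_lt_k_iff (hc : 0 < d.c₁ + d.A) : 1 < d.k ↔ d.c₁ + d.A < 2 * d.A := by
  rw [k, lt_sqrt zero_le_one, one_pow, one_lt_div hc]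

theorem IsPhase.one_lt_k_iff (hα : d.IsPhase α) (hEI : 0 < d.EI) (hc : 0 < d.c₁ + d.A) :
    1 < d.k ↔ d.M ^ 2 / d.EI < 2 * d.F * (1 + cos (d.φa + α)) := by
  have h1 : d.EI * (d.c₁ + d.A) = d.M ^ 2 / d.EI + 2 * d.F * (1 - cos (d.φa + α)) := by
    rw [hα.c₁_add_A, κa, A, cos_eq_one_sub_two_mul_sin_half_sq]; field_simp; ring
  have h2 : d.EI * (2 * d.A) = 4 * d.F := by rw [A]; field_simp; ring
  rw [EndData.one_lt_k_iff hc, ← mul_lt_mul_iff_right₀ hEI, h1, h2]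
  constructor <;> intro h <;> linarith

/-- At the initial half angle the energy identity equates `4 b²` times the radicand with `κa² ≥ 0`.
For `k = 1` the ends `±π/2` would force `M = 0` and `sin (φa + α) = 0`, the excluded case. -/
theorem IsPhase.initial_mem_amplitudes (hα : d.IsPhase α) (hEI : 0 < d.EI)
    (hd : d.M ≠ 0 ∨ d.X * sin d.φa + d.Z * cos d.φa ≠ 0) :
    (d.φa + α) / 2 ∈ amplitudes d.k := by
  have hs := curvSign_sq hEI hd
  have hc := c₁_add_A_pos hEI hd
  have hE := hα.energy hEI hs hc ((d.φa + α) / 2)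
  have hb : 0 < d.b ^ 2 := by linarith [b_sq hs hc]
  have hr : 0 ≤ 1 - d.k ^ 2 * sin ((d.φa + α) / 2) ^ 2 := by
    by_contra! h
    nlinarith [sq_nonneg d.κa]
  rcases lt_or_ge d.k 1 with h | h
  · exact mem_amplitudes_of_lt_one h _
  have hθ : |(d.φa + α) / 2| ≤ π / 2 := by
    rw [abs_div, abs_two]
    linarith [hα.branch h]
  rcases h.lt_or_eq with h | h
  · rw [mem_amplitudes_of_one_lt h, ← sq_le_one_iff_abs_le_one]
    exact ⟨hθ, by linarith [mul_pow d.k (sin ((d.φa + α) / 2)) 2]⟩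
  · rw [← h, amplitudes_one, mem_Ioo, ← abs_lt]
    refine lt_of_le_of_ne hθ fun heq => ?_
    have hsc : sin ((d.φa + α) / 2) ^ 2 = 1 ∧ cos ((d.φa + α) / 2) = 0 := by
      have hcos : cos ((d.φa + α) / 2) = 0 := by rw [← cos_abs, heq, cos_pi_div_two]
      exact ⟨by rw [sin_sq, hcos]; ring, hcos⟩
    rw [hsc.1, ← h] at hE
    have hκ : d.κa = 0 := by nlinarith
    have hM := (κa_eq_zero_iff hEI).1 hκ
    apply hd.resolve_left (not_not.2 hM)
    rw [hα.force_eq, sin_eq_two_mul_sin_half_mul_cos_half,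
      hsc.2]
    ring

end InextensibleBeam.EndData

namespace InextensibleBeam

open Real Set Topology

/-! ### Functions on an interval -/

theorem eq_of_hasDerivWithinAt_zero {L : ℝ} {f : ℝ → ℝ}
    (hf : ∀ x ∈ Icc 0 L, HasDerivWithinAt f 0 (Icc 0 L) x) {x : ℝ} (hx : x ∈ Icc 0 L) :
    f x = f 0 :=
  constant_of_has_deriv_right_zero (fun x hx => (hf x hx).continuousWithinAt)
    (fun y hy => (hf y ⟨hy.1, hy.2.le⟩).mono_of_mem_nhdsWithin
      (Filter.mem_of_superset (Icc_mem_nhdsGE hy.2) (Icc_subset_Icc_left hy.1))) x hx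

theorem hasDerivWithinAt_affine (a b x : ℝ) (s : Set ℝ) :
    HasDerivWithinAt (fun x => a + b * x) b s x :=
  (((hasDerivAt_id x).const_mul b).const_add a).hasDerivWithinAt.congr_deriv (mul_one _)

/-- Primitives on an interval differ by constants. -/
theorem forall_hasDerivWithinAt_iff {L : ℝ} {f f' : ℝ → ℝ}
    (hf : ∀ x ∈ Icc 0 L, HasDerivWithinAt f (f' x) (Icc 0 L) x) (u : ℝ → ℝ) :
    (∀ x ∈ Icc 0 L, HasDerivWithinAt u (f' x) (Icc 0 L) x) ↔
      ∃ C, ∀ x ∈ Icc 0 L, u x = C + f x := by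
  constructor
  · intro hu
    refine ⟨u 0 - f 0, fun x hx => ?_⟩
    have := eq_of_hasDerivWithinAt_zero (f := fun x => u x - f x)
      (fun y hy => ((hu y hy).sub (hf y hy)).congr_deriv (sub_self _)) hx
    linarith
  · rintro ⟨C, hC⟩ x hx
    exact ((hf x hx).const_add C).congr hC (hC x hx)

/-- A continuous function on `[0, L]` that starts in `(-c, c)` and omits `±c` stays there. -/
theorem mem_Ioo_of_ne {L c : ℝ} {θ : ℝ → ℝ} (hθ : ContinuousOn θ (Icc 0 L))
    (h0 : θ 0 ∈ Ioo (-c) c) (hne : ∀ x ∈ Icc 0 L, |θ x| ≠ c) {x : ℝ} (hx : x ∈ Icc 0 L) :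
    θ x ∈ Ioo (-c) c := by
  have hc : |θ 0| < c := abs_lt.2 h0
  rw [mem_Ioo, ← abs_lt]
  by_contra! h
  obtain ⟨y, hy, hyc⟩ := intermediate_value_Icc hx.1
    (hθ.abs.mono (Icc_subset_Icc_right hx.2)) ⟨hc.le, h⟩
  exact hne y ⟨hy.1, hy.2.trans hx.2⟩ hyc

namespace EndData

variable {d : EndData} {α L : ℝ} {φ : ℝ → ℝ}

/-! ### Rotations -/

theorem IsPhase.isRotation_of_eq_am (hα : d.IsPhase α) (hEI : 0 < d.EI) (hL : 0 < L)
    (hd : d.M ≠ 0 ∨ d.X * sin d.φa + d.Z * cos d.φa ≠ 0)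
    (h : ∀ x ∈ Icc 0 L, d.a α + d.b * x ∈ arguments d.k ∧
      φ x = 2 * am (d.a α + d.b * x) d.k - α) : d.IsRotation L φ := by
  have hs := curvSign_sq hEI hd
  have hc := c₁_add_A_pos hEI hd
  have hmaps : MapsTo (fun x => d.a α + d.b * x) (Icc 0 L) (arguments d.k) := fun x hx => (h x hx).1
  have ham0 : am (d.a α + d.b * 0) d.k = (d.φa + α) / 2 := by
    rw [mul_zero, add_zero, a, am_FJ d.k_nonneg (hα.initial_mem_amplitudes hEI hd)]
  have hφ0 : φ 0 = d.φa := by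
    rw [(h 0 ⟨le_rfl, hL.le⟩).2, ham0]; ring
  -- The curvature is `2 b dn` because `am' = dn`; its sign is that of `b`, since `dn ≥ 0`.
  refine ⟨fun x => 2 * d.b * dn (d.a α + d.b * x) d.k,
    fun x => -(d.X * sin (φ x) + d.Z * cos (φ x)) / d.EI, hφ0, ?_, ?_, ?_, ?_, ?_⟩
  · change 2 * d.b * dn (d.a α + d.b * 0) d.k = d.κa
    rw [hα.κa_eq hEI hs hc, dn, sn, ham0]
  · intro x hx
    have h1 := (hasDerivWithinAt_am d.k_nonneg (hmaps hx)).comp x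
      (hasDerivWithinAt_affine (d.a α) d.b x _) hmaps
    exact (((h1.const_mul 2).sub_const α).congr (fun y hy => (h y hy).2) (h x hx).2).congr_deriv
      (by ring)
  · intro x hx
    have h1 := (hasDerivWithinAt_dn d.k_nonneg (hmaps hx)).comp x
      (hasDerivWithinAt_affine (d.a α) d.b x _) hmaps
    refine (h1.const_mul (2 * d.b)).congr_deriv ?_
    have hbk := b_sq_mul_k_sq hEI hs hc
    beta_reduce
    rw [hα.force_eq, (h x hx).2, sub_add_cancel, sin_two_mul, sn, cn, neg_div, mul_div_right_comm,
      ← hbk]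
    ring
  · intro x _
    field_simp
    ring
  · intro x _ y _
    have h1 : 0 ≤ dn (d.a α + d.b * x) d.k := sqrt_nonneg _
    have h2 : 0 ≤ dn (d.a α + d.b * y) d.k := sqrt_nonneg _
    calc 0 ≤ (2 * d.b) ^ 2 * (dn (d.a α + d.b * x) d.k * dn (d.a α + d.b * y) d.k) := by positivity
      _ = _ := by ring

/-- A negative value would make `curvSign * κ ≤ 0` throughout. This contradicts its value `|κa|` at
`0` or, if `κa = 0`, its positive slope there. -/
theorem curvSign_mul_nonneg (hEI : 0 < d.EI) (hL : 0 < L)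
    (hd : d.M ≠ 0 ∨ d.X * sin d.φa + d.Z * cos d.φa ≠ 0) {κ κ' : ℝ → ℝ}
    (hκ0 : κ 0 = d.κa) (hκ : HasDerivWithinAt κ (κ' 0) (Icc 0 L) 0)
    (hode : d.EI * κ' 0 + d.X * sin d.φa + d.Z * cos d.φa = 0)
    (hsign : ∀ x ∈ Icc 0 L, ∀ y ∈ Icc 0 L, 0 ≤ κ x * κ y) {x : ℝ} (hx : x ∈ Icc 0 L) :
    0 ≤ d.curvSign * κ x := by
  by_contra! hneg
  have hle : ∀ y ∈ Icc 0 L, d.curvSign * κ y ≤ 0 := fun y hy => by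
    have h1 := hsign x hx y hy
    have hs := curvSign_sq hEI hd
    have h2 : 0 ≤ (d.curvSign * κ x) * (d.curvSign * κ y) := by
      calc 0 ≤ d.curvSign ^ 2 * (κ x * κ y) := by rw [hs]; linarith
        _ = _ := by ring
    by_contra! h3
    nlinarith
  have h0 : (0 : ℝ) ∈ Icc 0 L := ⟨le_rfl, hL.le⟩
  by_cases hz : d.κa = 0
  · have hM := (κa_eq_zero_iff hEI).1 hz
    have hforce := hd.resolve_left (not_not.2 hM)
    have hpos : 0 < d.curvSign * κ' 0 := by
      have h1 : -(d.X * sin d.φa + d.Z * cos d.φa) = d.EI * κ' 0 := by linarith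
      have h2 : d.curvSign = Real.sign (d.EI * κ' 0) := by
        rw [curvSign, if_neg (not_not.2 hz), h1]
      have hne : κ' 0 ≠ 0 := fun h => hforce (by rw [h] at h1; linarith)
      rw [h2]
      rcases lt_or_gt_of_ne hne with h | h
      · rw [sign_of_neg (mul_neg_of_pos_of_neg hEI h)]; linarith
      · rw [sign_of_pos (mul_pos hEI h)]; linarith
    have hder : HasDerivWithinAt (fun y => d.curvSign * κ y) (d.curvSign * κ' 0) (Ioi 0) 0 :=
      (hκ.const_mul _).mono_of_mem_nhdsWithin (Icc_mem_nhdsGT hL)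
    rw [hasDerivWithinAt_iff_tendsto_slope' (by simp)] at hder
    refine hpos.not_ge (le_of_tendsto hder ?_)
    filter_upwards [Ioc_mem_nhdsGT hL] with y hy
    rw [slope_def_field, hκ0, hz, mul_zero, sub_zero, sub_zero]
    exact div_nonpos_of_nonpos_of_nonneg (hle y ⟨hy.1.le, hy.2⟩) hy.1.le
  · have h1 := hle 0 h0
    rw [hκ0, curvSign_mul_κa] at h1
    exact hz (abs_eq_zero.1 (le_antisymm h1 (abs_nonneg _)))

/-- Along a rotation the half angle satisfies the energy equation. -/
theorem IsPhase.exists_curvature (hα : d.IsPhase α) (hEI : 0 < d.EI) (hL : 0 < L)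
    (hd : d.M ≠ 0 ∨ d.X * sin d.φa + d.Z * cos d.φa ≠ 0) (hφ : d.IsRotation L φ) :
    ∃ κ : ℝ → ℝ, φ 0 = d.φa ∧
      (∀ x ∈ Icc 0 L, HasDerivWithinAt φ (κ x) (Icc 0 L) x) ∧
      (∀ x ∈ Icc 0 L, HasDerivWithinAt κ (-(d.F / d.EI * sin (φ x + α))) (Icc 0 L) x) ∧
      (∀ x ∈ Icc 0 L, 0 ≤ d.curvSign * κ x) ∧
      (∀ x ∈ Icc 0 L, κ x ^ 2 = 4 * d.b ^ 2 * (1 - d.k ^ 2 * sin ((φ x + α) / 2) ^ 2)) := by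
  obtain ⟨κ, κ', hφ0, hκ0, hφd, hκd, hode, hsign⟩ := hφ
  have hs := curvSign_sq hEI hd
  have hc := c₁_add_A_pos hEI hd
  have h0 : (0 : ℝ) ∈ Icc 0 L := ⟨le_rfl, hL.le⟩
  have hκd' : ∀ x ∈ Icc 0 L,
      HasDerivWithinAt κ (-(d.F / d.EI * sin (φ x + α))) (Icc 0 L) x := fun x hx => by
    refine (hκd x hx).congr_deriv ?_
    have := hode x hx
    rw [add_assoc, hα.force_eq] at this
    field_simp
    linarith
  refine ⟨κ, hφ0, hφd, hκd', fun x hx => curvSign_mul_nonneg hEI hL hd hκ0 (hκd 0 h0)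
    (hφ0 ▸ hode 0 h0) hsign hx, fun x hx => ?_⟩
  -- The first integral: its derivative vanishes because `A = 2 F / EI`.
  have hconst := eq_of_hasDerivWithinAt_zero
    (f := fun x => κ x ^ 2 - d.A * cos (φ x + α)) (L := L) (fun y hy => by
      have h1 := ((hκd' y hy).pow 2).sub ((((hφd y hy).add_const α).cos).const_mul d.A)
      refine h1.congr_deriv ?_
      rw [A]
      norm_num
      ring) hx
  simp only [hκ0, hφ0] at hconst
  rw [hα.energy hEI hs hc]
  rw [cos_eq_one_sub_two_mul_sin_half_sq (φ x + α),
    cos_eq_one_sub_two_mul_sin_half_sq (d.φa + α)] at hconst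
  rw [κa]
  linarith

/-- Along a rotation the half angle stays among the amplitudes, and in the interior of `[0, L]` it
avoids the points where the radicand vanishes. -/
theorem IsPhase.half_mem_amplitudes (hα : d.IsPhase α) (hEI : 0 < d.EI)
    (hd : d.M ≠ 0 ∨ d.X * sin d.φa + d.Z * cos d.φa ≠ 0) {κ : ℝ → ℝ} (hφ0 : φ 0 = d.φa)
    (hφd : ∀ x ∈ Icc 0 L, HasDerivWithinAt φ (κ x) (Icc 0 L) x)
    (hκd : ∀ x ∈ Icc 0 L, HasDerivWithinAt κ (-(d.F / d.EI * sin (φ x + α))) (Icc 0 L) x)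
    (hsign : ∀ x ∈ Icc 0 L, 0 ≤ d.curvSign * κ x)
    (hen : ∀ x ∈ Icc 0 L, κ x ^ 2 = 4 * d.b ^ 2 * (1 - d.k ^ 2 * sin ((φ x + α) / 2) ^ 2)) :
    (∀ x ∈ Icc 0 L, (φ x + α) / 2 ∈ amplitudes d.k) ∧
      ∀ x ∈ Ioo 0 L, 0 < 1 - d.k ^ 2 * sin ((φ x + α) / 2) ^ 2 := by
  have hs := curvSign_sq hEI hd
  have hc := c₁_add_A_pos hEI hd
  have hb : 0 < d.b ^ 2 := by linarith [b_sq hs hc]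
  have hθc : ContinuousOn (fun x => (φ x + α) / 2) (Icc 0 L) := fun x hx =>
    ((hφd x hx).continuousWithinAt.add continuousWithinAt_const).div_const 2
  have hnonneg : ∀ x ∈ Icc 0 L, 0 ≤ 1 - d.k ^ 2 * sin ((φ x + α) / 2) ^ 2 := fun x hx => by
    by_contra! h
    nlinarith [hen x hx, sq_nonneg (κ x)]
  have hinit := hα.initial_mem_amplitudes hEI hd
  rcases le_or_gt d.k 1 with hk | hk
  · suffices h : ∀ x ∈ Icc 0 L, (φ x + α) / 2 ∈ amplitudes d.k from
      ⟨h, fun x hx => radicand_pos d.k_nonneg hk (h x ⟨hx.1.le, hx.2.le⟩)⟩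
    rcases hk.lt_or_eq with hk | hk
    · exact fun x _ => mem_amplitudes_of_lt_one hk _
    rw [hk, amplitudes_one] at hinit ⊢
    refine fun x hx => mem_Ioo_of_ne (θ := fun x => (φ x + α) / 2) hθc (by simpa [hφ0]) ?_ hx
    intro y hy hyc
    -- the constant is the only solution of the first order equation through `±π/2`
    have hκ : ∀ x ∈ Icc 0 L, κ x = 2 * d.b * |cos ((φ x + α) / 2)| := fun x hx => by
      rw [eq_of_sq_eq hs hc (hsign x hx) (hen x hx), hk, one_pow, one_mul, ← cos_sq', sqrt_sq_eq_abs]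
    have hlip : LipschitzWith ‖d.b‖₊ fun θ : ℝ => d.b * |cos θ| := by
      refine LipschitzWith.of_dist_le_mul fun s t => ?_
      rw [Real.dist_eq, Real.dist_eq, ← mul_sub, abs_mul]
      refine mul_le_mul_of_nonneg_left ?_ (abs_nonneg _)
      exact (abs_abs_sub_abs_le_abs_sub _ _).trans (abs_cos_sub_cos_le s t)
    have hcy : cos ((φ y + α) / 2) = 0 := by rw [← cos_abs, hyc, cos_pi_div_two]
    -- Uniqueness runs backwards from `y` to `0`, where the half angle lies strictly inside `(-π/2,
    -- π/2)`.
    have huniq := ODE_solution_unique_of_mem_Icc_left (a := 0) (b := y)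
      (v := fun _ θ => d.b * |cos θ|) (s := fun _ => univ) (K := ‖d.b‖₊)
      (f := fun x => (φ x + α) / 2) (g := fun _ => (φ y + α) / 2)
      (fun _ _ => hlip.lipschitzOnWith) (hθc.mono (Icc_subset_Icc_right hy.2))
      (fun t ht => by
        have htL : t ∈ Icc 0 L := ⟨ht.1.le, ht.2.trans hy.2⟩
        have h1 := (((hφd t htL).add_const α).div_const 2).mono_of_mem_nhdsWithin
          (Filter.mem_of_superset (Icc_mem_nhdsLE ht.1) (Icc_subset_Icc_right htL.2))
        exact h1.congr_deriv (by rw [hκ t htL]; ring))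
      (fun _ _ => mem_univ _) continuousOn_const
      (fun t _ => (hasDerivWithinAt_const _ _ _).congr_deriv (by rw [hcy]; simp))
      (fun _ _ => mem_univ _) rfl
    have h0 : (φ 0 + α) / 2 = (φ y + α) / 2 := huniq ⟨le_rfl, hy.1⟩
    have : |(φ 0 + α) / 2| < π / 2 := by rw [hφ0]; exact abs_lt.2 hinit
    rw [h0, hyc] at this
    exact lt_irrefl _ this
  -- At a zero of the cosine the radicand would be `1 - k² < 0`.
  · have hcos : ∀ x ∈ Icc 0 L, cos ((φ x + α) / 2) ≠ 0 := fun x hx h => by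
      have h1 := hnonneg x hx
      rw [sin_sq, h] at h1
      nlinarith
    have hmem : ∀ x ∈ Icc 0 L, (φ x + α) / 2 ∈ Ioo (-(π / 2)) (π / 2) := fun x hx => by
      have h0 : (0 : ℝ) ∈ Icc 0 L := ⟨le_rfl, hx.1.trans hx.2⟩
      have hne : ∀ x ∈ Icc 0 L, |(φ x + α) / 2| ≠ π / 2 := fun x hx h =>
        hcos x hx (by rw [← cos_abs, h, cos_pi_div_two])
      refine mem_Ioo_of_ne (θ := fun x => (φ x + α) / 2) hθc ?_ hne hx
      refine abs_lt.1 (lt_of_le_of_ne ?_ (hne 0 h0))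
      rw [hφ0]
      exact abs_le_pi_div_two_of_mem_amplitudes hk.le hinit
    refine ⟨fun x hx => ?_, fun x hx => ?_⟩
    · rw [mem_amplitudes_of_one_lt hk, ← sq_le_one_iff_abs_le_one]
      exact ⟨(abs_lt.2 (hmem x hx)).le,
        by linarith [hnonneg x hx, mul_pow d.k (sin ((φ x + α) / 2)) 2]⟩
    · have hxL : x ∈ Icc 0 L := ⟨hx.1.le, hx.2.le⟩
      refine (hnonneg x hxL).lt_of_ne fun h => ?_
      have hκx : κ x = 0 := by
        have := hen x hxL
        rw [← h, mul_zero] at this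
        exact pow_eq_zero_iff two_ne_zero |>.1 this
      have hnhds : Icc 0 L ∈ 𝓝 x := Icc_mem_nhds hx.1 hx.2
      -- An interior zero of `κ` minimizes `curvSign * κ`, so `κ' = 0` and `sin (φ + α) = 0`; yet
      -- neither the sine nor the cosine of the half angle vanishes there.
      have hmin : IsLocalMin (fun y => d.curvSign * κ y) x := by
        filter_upwards [hnhds] with y hy
        simpa [hκx] using hsign y hy
      have hz := hmin.hasDerivAt_eq_zero (((hκd x hxL).hasDerivAt hnhds).const_mul d.curvSign)
      have hs0 : d.curvSign ≠ 0 := fun h => by rw [h] at hs; norm_num at hs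
      have hF : d.F / d.EI ≠ 0 := by
        rw [← b_sq_mul_k_sq hEI hs hc]
        exact mul_ne_zero hb.ne' (by positivity)
      have hsin0 : sin ((φ x + α) / 2) ≠ 0 := fun h' => by rw [h'] at h; norm_num at h
      rw [sin_eq_two_mul_sin_half_mul_cos_half (φ x + α)] at hz
      exact mul_ne_zero hs0 (neg_ne_zero.2 (mul_ne_zero hF
        (mul_ne_zero (mul_ne_zero two_ne_zero hsin0) (hcos x hxL)))) hz

theorem IsPhase.eq_am_of_isRotation (hα : d.IsPhase α) (hEI : 0 < d.EI) (hL : 0 < L)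
    (hd : d.M ≠ 0 ∨ d.X * sin d.φa + d.Z * cos d.φa ≠ 0) (hφ : d.IsRotation L φ) :
    ∀ x ∈ Icc 0 L, d.a α + d.b * x ∈ arguments d.k ∧
      φ x = 2 * am (d.a α + d.b * x) d.k - α := by
  have hs := curvSign_sq hEI hd
  have hc := c₁_add_A_pos hEI hd
  obtain ⟨κ, hφ0, hφd, hκd, hsign, hen⟩ := hα.exists_curvature hEI hL hd hφ
  obtain ⟨hmem, hpos⟩ := hα.half_mem_amplitudes hEI hd hφ0 hφd hκd hsign hen
  have hcont : ContinuousOn (fun x => FJ ((φ x + α) / 2) d.k) (Icc 0 L) :=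
    (continuousOn_FJ d.k_nonneg).comp (fun x hx =>
      ((hφd x hx).continuousWithinAt.add continuousWithinAt_const).div_const 2) hmem
  have hFJ : ∀ x ∈ Icc 0 L, FJ ((φ x + α) / 2) d.k = d.a α + d.b * x := by
    intro x hx
    rcases hx.1.eq_or_lt with rfl | hx0
    · rw [hφ0, a]; ring
    -- The mean value theorem needs the derivative `b` only in the interior, so the radicand may
    -- vanish at `0` or `L`.
    obtain ⟨c, -, hcx⟩ := exists_hasDerivAt_eq_slope (fun x => FJ ((φ x + α) / 2) d.k)
      (fun _ => d.b) hx0 (hcont.mono (Icc_subset_Icc_right hx.2)) (fun y hy => by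
        have hyL : y ∈ Ioo 0 L := ⟨hy.1, hy.2.trans_le hx.2⟩
        have hyL' : y ∈ Icc 0 L := ⟨hyL.1.le, hyL.2.le⟩
        have h1 := (((hφd y hyL').hasDerivAt (Icc_mem_nhds hyL.1 hyL.2)).add_const α).div_const 2
        have h2 := (hasStrictDerivAt_FJ d.k_nonneg (hmem y hyL') (hpos y hyL)).hasDerivAt
        refine (HasDerivAt.comp y h2 h1).congr_deriv ?_
        rw [eq_of_sq_eq hs hc (hsign y hyL') (hen y hyL')]
        have := (sqrt_pos.2 (hpos y hyL)).ne'
        field_simp)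
    rw [eq_div_iff (by linarith), hφ0] at hcx
    rw [a]
    linarith
  intro x hx
  rw [← hFJ x hx, am_FJ d.k_nonneg (hmem x hx)]
  exact ⟨⟨_, hmem x hx, rfl⟩, by ring⟩

theorem IsPhase.isRotation_iff (hα : d.IsPhase α) (hEI : 0 < d.EI) (hL : 0 < L)
    (hd : d.M ≠ 0 ∨ d.X * sin d.φa + d.Z * cos d.φa ≠ 0) (φ : ℝ → ℝ) :
    d.IsRotation L φ ↔ ∀ x ∈ Icc 0 L, d.a α + d.b * x ∈ arguments d.k ∧
      φ x = 2 * am (d.a α + d.b * x) d.k - α :=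
  ⟨hα.eq_am_of_isRotation hEI hL hd, hα.isRotation_of_eq_am hEI hL hd⟩

end EndData

end InextensibleBeam

namespace InextensibleBeam

open Real Set

theorem isDisplacement_iff {L : ℝ} {φ f g : ℝ → ℝ}
    (hf : ∀ x ∈ Icc 0 L, HasDerivWithinAt f (cos (φ x) - 1) (Icc 0 L) x)
    (hg : ∀ x ∈ Icc 0 L, HasDerivWithinAt g (-sin (φ x)) (Icc 0 L) x) (u w : ℝ → ℝ) :
    IsDisplacement L φ u w ↔
      ∃ Cu Cw, ∀ x ∈ Icc 0 L, u x = Cu + f x ∧ w x = Cw + g x := by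
  have hu := forall_hasDerivWithinAt_iff hf u
  have hw := forall_hasDerivWithinAt_iff hg w
  simp only [IsDisplacement, forall_and, hu, hw, exists_and_left, exists_and_right]

namespace EndData

variable {d : EndData} {α L : ℝ} {φ : ℝ → ℝ}

/-! ### Displacements -/

/-- Displacements in terms of a primitive `q` of `cos (φ + α)` and a primitive `-p` of
`sin (φ + α)`. -/
theorem isDisplacement_iff_of_primitives (α : ℝ) {p q : ℝ → ℝ}
    (hp : ∀ x ∈ Icc 0 L, HasDerivWithinAt p (-sin (φ x + α)) (Icc 0 L) x)
    (hq : ∀ x ∈ Icc 0 L, HasDerivWithinAt q (cos (φ x + α)) (Icc 0 L) x) (u w : ℝ → ℝ) :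
    IsDisplacement L φ u w ↔ ∃ Cu Cw : ℝ, ∀ x ∈ Icc 0 L,
      u x = Cu - x - p x * sin α + q x * cos α ∧
      w x = Cw + p x * cos α + q x * sin α := by
  rw [isDisplacement_iff (f := fun x => -x - p x * sin α + q x * cos α)
    (g := fun x => p x * cos α + q x * sin α)]
  · have h1 : ∀ C x : ℝ, C + (-x - p x * sin α + q x * cos α)
        = C - x - p x * sin α + q x * cos α := fun C x => by ring
    have h2 : ∀ C x : ℝ, C + (p x * cos α + q x * sin α)
        = C + p x * cos α + q x * sin α := fun C x => by ring
    simp only [h1, h2]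
  · intro x hx
    refine (((hasDerivWithinAt_id x _).neg.sub ((hp x hx).mul_const (sin α))).add
      ((hq x hx).mul_const (cos α))).congr_deriv ?_
    have : cos (φ x) = cos (φ x + α - α) := by ring_nf
    rw [this, cos_sub]; ring
  · intro x hx
    refine (((hp x hx).mul_const (cos α)).add ((hq x hx).mul_const (sin α))).congr_deriv ?_
    have : sin (φ x) = sin (φ x + α - α) := by ring_nf
    rw [this, sin_sub]; ring

theorem k_pos (hEI : 0 < d.EI) (hc : 0 < d.c₁ + d.A) (hF : 0 < d.F) : 0 < d.k :=
  sqrt_pos.2 (div_pos (by rw [A]; positivity) hc)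

theorem F_pos_of_one_lt_k (h : 1 < d.k) : 0 < d.F :=
  d.F_nonneg.lt_of_ne fun hF => by
    have : d.k = 0 := by simp [k, A, ← hF]
    linarith

theorem hasDerivWithinAt_dn_term (hEI : 0 < d.EI)
    (hd : d.M ≠ 0 ∨ d.X * sin d.φa + d.Z * cos d.φa ≠ 0) (hF : 0 < d.F)
    (h : ∀ x ∈ Icc 0 L, d.a α + d.b * x ∈ arguments d.k ∧
      φ x = 2 * am (d.a α + d.b * x) d.k - α) {x : ℝ} (hx : x ∈ Icc 0 L) :
    HasDerivWithinAt (fun x => 2 / (d.b * d.k ^ 2) * dn (d.a α + d.b * x) d.k)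
      (-sin (φ x + α)) (Icc 0 L) x := by
  have hc := c₁_add_A_pos hEI hd
  have hb := b_ne_zero (curvSign_sq hEI hd) hc
  have hk := k_pos hEI hc hF
  have hmaps : MapsTo (fun x => d.a α + d.b * x) (Icc 0 L) (arguments d.k) := fun x hx => (h x hx).1
  have h1 := (hasDerivWithinAt_dn d.k_nonneg (hmaps hx)).comp x
    (hasDerivWithinAt_affine (d.a α) d.b x _) hmaps
  refine (h1.const_mul _).congr_deriv ?_
  rw [(h x hx).2, sub_add_cancel, sin_two_mul, sn, cn]
  field_simp

/-- Eliminating `sn²` from `cos 2θ = 1 - 2 sn²` by `dn² = 1 - k² sn²` gives `cos (φ + α) = 2 dn² /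
k² + 1 - 2 / k²`. -/
theorem hasDerivWithinAt_EJ_term (hEI : 0 < d.EI)
    (hd : d.M ≠ 0 ∨ d.X * sin d.φa + d.Z * cos d.φa ≠ 0) (hF : 0 < d.F)
    (h : ∀ x ∈ Icc 0 L, d.a α + d.b * x ∈ arguments d.k ∧
      φ x = 2 * am (d.a α + d.b * x) d.k - α) {x : ℝ} (hx : x ∈ Icc 0 L) :
    HasDerivWithinAt
      (fun x => 2 / (d.b * d.k ^ 2) * EJ (am (d.a α + d.b * x) d.k) d.k + x - 2 * x / d.k ^ 2)
      (cos (φ x + α)) (Icc 0 L) x := by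
  have hc := c₁_add_A_pos hEI hd
  have hb := b_ne_zero (curvSign_sq hEI hd) hc
  have hk := k_pos hEI hc hF
  have hmaps : MapsTo (fun x => d.a α + d.b * x) (Icc 0 L) (arguments d.k) := fun x hx => (h x hx).1
  have h1 := (hasDerivWithinAt_EJ_am d.k_nonneg (hmaps hx)).comp x
    (hasDerivWithinAt_affine (d.a α) d.b x _) hmaps
  have hid := hasDerivWithinAt_id x (Icc 0 L)
  refine (((h1.const_mul (2 / (d.b * d.k ^ 2))).add hid).sub
    ((hid.const_mul 2).div_const (d.k ^ 2))).congr_deriv ?_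
  rw [dn_sq d.k_nonneg (hmaps hx), (h x hx).2, sub_add_cancel, cos_two_mul', cos_sq', sn]
  field_simp
  ring

theorem IsPhase.isDisplacement_iff (hα : d.IsPhase α) (hEI : 0 < d.EI) (hL : 0 < L)
    (hd : d.M ≠ 0 ∨ d.X * sin d.φa + d.Z * cos d.φa ≠ 0) (hF : 0 < d.F)
    (hφ : d.IsRotation L φ) (u w : ℝ → ℝ) :
    IsDisplacement L φ u w ↔ ∃ Cu Cw : ℝ, ∀ x ∈ Icc 0 L,
      u x = Cu - x - 2 / (d.b * d.k ^ 2) * dn (d.a α + d.b * x) d.k * sin α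
        + (2 / (d.b * d.k ^ 2) * EJ (am (d.a α + d.b * x) d.k) d.k + x - 2 * x / d.k ^ 2)
          * cos α ∧
      w x = Cw + 2 / (d.b * d.k ^ 2) * dn (d.a α + d.b * x) d.k * cos α
        + (2 / (d.b * d.k ^ 2) * EJ (am (d.a α + d.b * x) d.k) d.k + x - 2 * x / d.k ^ 2)
          * sin α := by
  have h := (hα.isRotation_iff hEI hL hd φ).1 hφ
  exact isDisplacement_iff_of_primitives α
    (fun _ hx => hasDerivWithinAt_dn_term hEI hd hF h hx)
    (fun _ hx => hasDerivWithinAt_EJ_term hEI hd hF h hx) u w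

/-! ### The reciprocal modulus -/

theorem IsPhase.ktil_eq (hα : d.IsPhase α) (hEI : 0 < d.EI) (hF : 0 < d.F) :
    d.ktil = sqrt (sin ((d.φa + α) / 2) ^ 2 + d.M ^ 2 / (4 * d.EI * d.F)) := by
  rw [ktil, k, one_div, ← sqrt_inv, inv_div, hα.c₁_add_A, κa, A]
  congr 1
  field_simp
  ring

theorem IsPhase.atil_eq (hα : d.IsPhase α) (hEI : 0 < d.EI)
    (hd : d.M ≠ 0 ∨ d.X * sin d.φa + d.Z * cos d.φa ≠ 0) (hk : 1 < d.k) :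
    d.atil α = FJ (arcsin (1 / d.ktil * sin ((d.φa + α) / 2))) d.ktil := by
  rw [atil, a, FJ_reciprocal hk (hα.initial_mem_amplitudes hEI hd), ktil, one_div_one_div]

theorem btil_eq (hEI : 0 < d.EI) (hc : 0 < d.c₁ + d.A) :
    d.btil = sqrt (d.F / d.EI) * d.curvSign := by
  have h : d.F / d.EI = (d.k * (sqrt (d.c₁ + d.A) / 2)) ^ 2 := by
    rw [mul_pow, div_pow, sq_sqrt hc.le, mul_div_assoc', k_sq_mul hEI hc, A]; ring
  rw [h, sqrt_sq (mul_nonneg d.k_nonneg (by positivity)), btil, b]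
  ring

theorem atil_add_btil_mul (d : EndData) (α x : ℝ) :
    d.atil α + d.btil * x = d.k * (d.a α + d.b * x) := by
  rw [atil, btil]; ring

theorem IsPhase.isRotation_iff_reciprocal (hα : d.IsPhase α) (hEI : 0 < d.EI) (hL : 0 < L)
    (hd : d.M ≠ 0 ∨ d.X * sin d.φa + d.Z * cos d.φa ≠ 0) (hk : 1 < d.k) (φ : ℝ → ℝ) :
    d.IsRotation L φ ↔ ∀ x ∈ Icc 0 L, |d.atil α + d.btil * x| ≤ K d.ktil ∧
      φ x = 2 * arcsin (d.ktil * sn (d.atil α + d.btil * x) d.ktil) - α := by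
  rw [hα.isRotation_iff hEI hL hd]
  refine forall₂_congr fun x _ => ?_
  rw [atil_add_btil_mul, ktil, ← mem_arguments_reciprocal hk]
  refine and_congr_right fun h => ?_
  rw [am_eq_arcsin_reciprocal hk h]

theorem IsPhase.isDisplacement_iff_reciprocal (hα : d.IsPhase α) (hEI : 0 < d.EI) (hL : 0 < L)
    (hd : d.M ≠ 0 ∨ d.X * sin d.φa + d.Z * cos d.φa ≠ 0) (hk : 1 < d.k)
    (hφ : d.IsRotation L φ) (u w : ℝ → ℝ) :
    IsDisplacement L φ u w ↔ ∃ Cu Cw : ℝ, ∀ x ∈ Icc 0 L,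
      u x = Cu - x - 2 * d.ktil / d.btil * cn (d.atil α + d.btil * x) d.ktil * sin α
        + (2 / d.btil * EJ (am (d.atil α + d.btil * x) d.ktil) d.ktil - x) * cos α ∧
      w x = Cw + 2 * d.ktil / d.btil * cn (d.atil α + d.btil * x) d.ktil * cos α
        + (2 / d.btil * EJ (am (d.atil α + d.btil * x) d.ktil) d.ktil - x) * sin α := by
  have h := (hα.isRotation_iff hEI hL hd φ).1 hφ
  have hF := F_pos_of_one_lt_k hk
  have hb := b_ne_zero (curvSign_sq hEI hd) (c₁_add_A_pos hEI hd)
  have hk0 : d.k ≠ 0 := by linarith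
  have hbt : d.btil ≠ 0 := mul_ne_zero hk0 hb
  refine isDisplacement_iff_of_primitives α (fun x hx => ?_) (fun x hx => ?_) u w
  · have heq : ∀ y ∈ Icc 0 L, 2 * d.ktil / d.btil * cn (d.atil α + d.btil * y) d.ktil
        = 2 / (d.b * d.k ^ 2) * dn (d.a α + d.b * y) d.k := fun y hy => by
      rw [atil_add_btil_mul, ktil, cn_reciprocal hk (h y hy).1, btil]
      field_simp
    exact (hasDerivWithinAt_dn_term hEI hd hF h hx).congr heq (heq x hx)
  -- Differentiating directly in the modulus `1/k` gives `2 dn² - 1`, and this `dn` equals `cn` of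
  -- modulus `k`, so the result is `2 cos² θ - 1`.
  · have hmaps : MapsTo (fun x => d.atil α + d.btil * x) (Icc 0 L) (arguments d.ktil) :=
      fun y hy => by
        simp only [atil_add_btil_mul]
        exact mul_mem_arguments_reciprocal hk (h y hy).1
    have hkt : 0 ≤ d.ktil := one_div_nonneg.2 d.k_nonneg
    have h1 := (hasDerivWithinAt_EJ_am hkt (hmaps hx)).comp x
      (hasDerivWithinAt_affine (d.atil α) d.btil x _) hmaps
    refine ((h1.const_mul (2 / d.btil)).sub (hasDerivWithinAt_id x (Icc 0 L))).congr_deriv ?_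
    have hdn : dn (d.atil α + d.btil * x) d.ktil = cn (d.a α + d.b * x) d.k := by
      rw [atil_add_btil_mul, ktil, dn_reciprocal hk (h x hx).1]
    rw [hdn, (h x hx).2, sub_add_cancel, cos_two_mul, cn]
    field_simp

end EndData

end InextensibleBeam

theorem mainTheorem2 (d : EndData) (hEI : 0 < d.EI) (L : ℝ) (hL : 0 < L)
    (hd : d.M ≠ 0 ∨ d.X * Real.sin d.φa + d.Z * Real.cos d.φa ≠ 0) :
    -- the phase angle
    (∃ α, d.IsPhase α) ∧
    (0 < d.X → (1 ≤ d.k → |d.φa + Real.arctan (d.Z / d.X)| ≤ Real.pi) →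
      d.IsPhase (Real.arctan (d.Z / d.X))) ∧
    -- the modulus
    0 < d.c₁ + d.A ∧
    d.k = Real.sqrt (4 * d.F / (2 * (d.F + d.N) + d.EI * d.κa ^ 2)) ∧
    ∀ α, d.IsPhase α →
      (1 < d.k ↔ d.M ^ 2 / d.EI < 2 * d.F * (1 + Real.cos (d.φa + α))) ∧
      -- rotation
      (∀ φ : ℝ → ℝ, d.IsRotation L φ ↔
        ∀ x ∈ Set.Icc 0 L, d.a α + d.b * x ∈ arguments d.k ∧
          φ x = 2 * am (d.a α + d.b * x) d.k - α) ∧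
      -- displacements
      (0 < d.F → ∀ φ : ℝ → ℝ, d.IsRotation L φ → ∀ u w : ℝ → ℝ,
        (IsDisplacement L φ u w ↔ ∃ Cu Cw : ℝ, ∀ x ∈ Set.Icc 0 L,
          u x = Cu - x - 2 / (d.b * d.k ^ 2) * dn (d.a α + d.b * x) d.k * Real.sin α
            + (2 / (d.b * d.k ^ 2) * EJ (am (d.a α + d.b * x) d.k) d.k + x - 2 * x / d.k ^ 2)
              * Real.cos α ∧
          w x = Cw + 2 / (d.b * d.k ^ 2) * dn (d.a α + d.b * x) d.k * Real.cos α
            + (2 / (d.b * d.k ^ 2) * EJ (am (d.a α + d.b * x) d.k) d.k + x - 2 * x / d.k ^ 2)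
              * Real.sin α)) ∧
      -- the form with the reciprocal modulus
      (1 < d.k →
        d.ktil = Real.sqrt (Real.sin ((d.φa + α) / 2) ^ 2 + d.M ^ 2 / (4 * d.EI * d.F)) ∧
        d.atil α = FJ (Real.arcsin (1 / d.ktil * Real.sin ((d.φa + α) / 2))) d.ktil ∧
        d.btil = Real.sqrt (d.F / d.EI) * d.curvSign ∧
        (∀ φ : ℝ → ℝ, d.IsRotation L φ ↔
          ∀ x ∈ Set.Icc 0 L, |d.atil α + d.btil * x| ≤ K d.ktil ∧
            φ x = 2 * Real.arcsin (d.ktil * sn (d.atil α + d.btil * x) d.ktil) - α) ∧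
        (∀ φ : ℝ → ℝ, d.IsRotation L φ → ∀ u w : ℝ → ℝ,
          (IsDisplacement L φ u w ↔ ∃ Cu Cw : ℝ, ∀ x ∈ Set.Icc 0 L,
            u x = Cu - x - 2 * d.ktil / d.btil * cn (d.atil α + d.btil * x) d.ktil * Real.sin α
              + (2 / d.btil * EJ (am (d.atil α + d.btil * x) d.ktil) d.ktil - x)
                * Real.cos α ∧
            w x = Cw + 2 * d.ktil / d.btil * cn (d.atil α + d.btil * x) d.ktil * Real.cos α
              + (2 / d.btil * EJ (am (d.atil α + d.btil * x) d.ktil) d.ktil - x)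
                * Real.sin α))) := by
  have hc := EndData.c₁_add_A_pos hEI hd
  refine ⟨d.exists_isPhase, EndData.isPhase_arctan, hc, EndData.k_eq hEI, fun α hα => ?_⟩
  refine ⟨hα.one_lt_k_iff hEI hc, hα.isRotation_iff hEI hL hd,
    fun hF φ hφ u w => hα.isDisplacement_iff hEI hL hd hF hφ u w, fun hk => ?_⟩
  exact ⟨hα.ktil_eq hEI (EndData.F_pos_of_one_lt_k hk), hα.atil_eq hEI hd hk,
    EndData.btil_eq hEI hc, hα.isRotation_iff_reciprocal hEI hL hd hk,
    fun φ hφ u w => hα.isDisplacement_iff_reciprocal hEI hL hd hk hφ u w⟩
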